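/- Let $m$ be a positive integer, $q=2^m$, let $F=\mathbb{F}_q$ be the finite field with $q$ elements, and let $\mathrm{Tr}$ be the trace function of $F$ over $\mathbb{F}_2$. For $a\in F$ let $$K(a)=\sum_{x\in F\setminus\{0\}}(-1)^{\mathrm{Tr}(ax+1/x)}$$ be the Kloosterman sum. Then for every $b\in F$ with $b\neq 1$, $$K\left(\frac{(b^3+b^2+1)(b^3+b^2+b)^3}{(1+b)^4}\right)=K\left(\frac{(b^3+b^2+1)^3(b^3+b^2+b)}{(1+b)^4}\right).$$ -/

import Mathlib

/-- The Kloosterman sum `K(a) = ∑_{x ∈ F, x ≠ 0} (-1)^{Tr(a x + 1/x)}` over a finite field `F` of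
characteristic two, where `Tr` is the trace of `F` over `𝔽₂`. The exponent is the representative
`0` or `1` of the trace. -/
noncomputable def kloosterman {F : Type*} [Field F] [Fintype F] [DecidableEq F]
    [Algebra (ZMod 2) F] (a : F) : ℤ :=
  ∑ x ∈ Finset.univ.filter (fun x : F => x ≠ 0),
    (-1 : ℤ) ^ (Algebra.trace (ZMod 2) F (a * x + 1 / x)).val

section TraceCharTwo

/-! With a = (b^3+b^2+1)/(1+b) the claim is K(a^3(a+1)) = K(a(a+1)^3). Each sum is determined by the
number of x ≠ 0 with Tr(x + A/x) ≠ Tr(a), so these counts are matched by a 3-isogeny x ↦ z. The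
points over z correspond to roots t of t^3 + (1+a^2+z)t = z. By `trace_resolvent_eq` the condition
on z says that the resolvent trace of this cubic differs from Tr(1), which forces exactly one root;
hence the isogeny is a bijection on the counted points. -/

lemma two_eq_zero_of_algebra_zmod_two {F : Type*} [Field F] [Algebra (ZMod 2) F] : (2 : F) = 0 := by
  have := charP_of_injective_algebraMap (algebraMap (ZMod 2) F).injective 2
  exact CharTwo.two_eq_zero

variable {F : Type*} [Field F] [Fintype F] [Algebra (ZMod 2) F]

lemma trace_sq (x : F) :
    Algebra.trace (ZMod 2) F (x ^ 2) = Algebra.trace (ZMod 2) F x := by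
  have h := Algebra.trace_eq_of_algEquiv (FiniteField.frobeniusAlgEquivOfAlgebraic (ZMod 2) F) x
  simpa [FiniteField.coe_frobeniusAlgEquivOfAlgebraic, ZMod.card] using h

/-- Elements differing by `y ^ 2 + y` have the same trace. -/
lemma trace_eq_of_add_sq_add {u v y : F} (h : u = v + (y ^ 2 + y)) :
    Algebra.trace (ZMod 2) F u = Algebra.trace (ZMod 2) F v := by
  rw [h, map_add, map_add, trace_sq, CharTwo.add_self_eq_zero, add_zero]

/-- If a cubic `t ^ 3 + p t + q` has two distinct roots, its resolvent has the trace of `1`. -/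
lemma trace_resolvent_of_two_roots {p q s t : F} (hq : q ≠ 0) (hst : s ≠ t)
    (hs : s ^ 3 + p * s = q) (ht : t ^ 3 + p * t = q) :
    Algebra.trace (ZMod 2) F (p ^ 3 / q ^ 2) = Algebra.trace (ZMod 2) F 1 := by
  have h2 : (2 : F) = 0 := two_eq_zero_of_algebra_zmod_two
  have hsub : s - t ≠ 0 := sub_ne_zero.mpr hst
  have hp : p = s ^ 2 + s * t + t ^ 2 := by
    apply mul_left_cancel₀ hsub
    linear_combination hs - ht - (s ^ 3 - t ^ 3) * h2
  have hq' : q = s * t * (s + t) := by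
    linear_combination -hs + s * hp + s ^ 3 * h2
  have hs0 : s ≠ 0 := by rintro rfl; simp [hq'] at hq
  have ht0 : t ≠ 0 := by rintro rfl; simp [hq'] at hq
  have hst0 : s + t ≠ 0 := fun h => by simp [hq', h] at hq
  -- With third root r = s + t, q y = s^2 t + t^2 r + r^2 s, a root of the quadratic resolvent Y^2 +
  -- qY = p^3 + q^2.
  apply trace_eq_of_add_sq_add (y := s / t + t ^ 2 / (s * (s + t)))
  rw [hp, hq']
  field_simp
  grind

/-- The trace of the resolvent of a cubic `t ^ 3 + p t + q`, computed from a root. -/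
lemma trace_resolvent_of_root {p q t : F} (hq : q ≠ 0) (ht : t ^ 3 + p * t = q) :
    Algebra.trace (ZMod 2) F (p ^ 3 / q ^ 2) = Algebra.trace (ZMod 2) F (p / t ^ 2) := by
  have h2 : (2 : F) = 0 := two_eq_zero_of_algebra_zmod_two
  have ht0 : t ≠ 0 := by rintro rfl; apply hq; simp [← ht]
  have hd : t ^ 2 + p ≠ 0 := fun h => hq (by linear_combination -ht + t * h)
  subst ht
  apply trace_eq_of_add_sq_add (y := t ^ 2 / (t ^ 2 + p))
  have : t ^ 3 + p * t = t * (t ^ 2 + p) := by ring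
  rw [this]
  field_simp
  grind

/-- A cubic whose resolvent does not have the trace of `1` has a root. -/
lemma exists_root_of_trace_resolvent_ne {p q : F} (hq : q ≠ 0)
    (h : Algebra.trace (ZMod 2) F (p ^ 3 / q ^ 2) ≠ Algebra.trace (ZMod 2) F 1) :
    ∃ t, t ^ 3 + p * t = q := by
  classical
  -- For fixed p, t ↦ t^3 + p t injects S into T, and q ↦ q / p shows that T is no larger than S, so
  -- the map is onto T. The condition in S says that X^2 + tX + (t^2 + p), the cofactor of the root
  -- t, does not split.
  let T : Finset F := Finset.univ.filter fun q => q ≠ 0 ∧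
    Algebra.trace (ZMod 2) F (p ^ 3 / q ^ 2) ≠ Algebra.trace (ZMod 2) F 1
  let S : Finset F := Finset.univ.filter fun t => t ≠ 0 ∧
    Algebra.trace (ZMod 2) F (p / t ^ 2) ≠ Algebra.trace (ZMod 2) F 1
  have hcard : T.card ≤ S.card := by
    by_cases hp : p = 0
    · simp [T, S, hp]
    · apply Finset.card_le_card_of_injOn (fun q => q / p)
      · intro q hq
        simp only [T, S, Finset.coe_filter, Finset.mem_univ, true_and, Set.mem_ofPred_eq] at hq ⊢
        refine ⟨div_ne_zero hq.1 hp, ?_⟩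
        have : p / (q / p) ^ 2 = p ^ 3 / q ^ 2 := by
          have := hq.1
          field_simp
        rw [this]
        exact hq.2
      · intro x _ y _ hxy
        exact (div_left_inj' hp).mp hxy
  have hmaps : Set.MapsTo (fun t => t ^ 3 + p * t) (S : Set F) T := by
    intro t ht
    simp only [T, S, Finset.coe_filter, Finset.mem_univ, true_and, Set.mem_ofPred_eq] at ht ⊢
    have h0 : t ^ 3 + p * t ≠ 0 := by
      intro h0
      apply ht.2
      have h2 : (2 : F) = 0 := two_eq_zero_of_algebra_zmod_two
      have : p / t ^ 2 = 1 := by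
        have ht0 := ht.1
        rw [div_eq_one_iff_eq (pow_ne_zero 2 ht0)]
        apply mul_left_cancel₀ ht0
        linear_combination h0 - t ^ 3 * h2
      rw [this]
    exact ⟨h0, trace_resolvent_of_root h0 rfl ▸ ht.2⟩
  have hinj : Set.InjOn (fun t => t ^ 3 + p * t) (S : Set F) := by
    intro s hs t ht hst
    by_contra hne
    have hsT := hmaps hs
    simp only [T, Finset.coe_filter, Finset.mem_univ, true_and, Set.mem_ofPred_eq] at hsT
    exact hsT.2 (trace_resolvent_of_two_roots hsT.1 hne rfl hst.symm)
  have hqT : q ∈ T := by simp [T, hq, h]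
  obtain ⟨t, -, ht⟩ := Finset.surjOn_of_injOn_of_card_le _ hmaps hinj hcard hqT
  exact ⟨t, ht⟩

/-- The trace of `x + A / x` along the `3`-isogeny `x ↦ z`, where `x = a ^ 2 t / (t + 1)` and
`t` is a root of the cubic of `z`. -/
lemma trace_add_div_eq_resolvent {a x t : F} (ht : t ≠ 0) (ht1 : t + 1 ≠ 0)
    (hx : x = a ^ 2 * t / (t + 1)) :
    Algebra.trace (ZMod 2) F (x + a ^ 3 * (a + 1) / x) + Algebra.trace (ZMod 2) F (1 + a) =
      Algebra.trace (ZMod 2) F ((1 + a ^ 2 + (t ^ 2 + t + x)) / t ^ 2) := by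
  have h2 : (2 : F) = 0 := two_eq_zero_of_algebra_zmod_two
  rw [← map_add]
  symm
  apply trace_eq_of_add_sq_add (y := (1 + a) / t)
  subst hx
  field_simp
  grind

/-- Links the summand at z to the resolvent of the cubic with p = 1 + a^2 + z and q = z, whose roots
t parametrize the fibre over z. -/
lemma trace_resolvent_eq {a z : F} (hz : z ≠ 0) :
    Algebra.trace (ZMod 2) F ((1 + a ^ 2 + z) ^ 3 / z ^ 2) =
      Algebra.trace (ZMod 2) F (z + a * (a + 1) ^ 3 / z) +
        Algebra.trace (ZMod 2) F (1 + a) := by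
  have h2 : (2 : F) = 0 := two_eq_zero_of_algebra_zmod_two
  rw [← map_add]
  apply trace_eq_of_add_sq_add (y := (1 + a) ^ 3 / z + a)
  field_simp
  grind

end TraceCharTwo

section Kloosterman

variable {F : Type*} [Field F] [Fintype F] [DecidableEq F] [Algebra (ZMod 2) F]

lemma neg_one_pow_val_eq (c e : ZMod 2) :
    (-1 : ℤ) ^ c.val = (-1) ^ e.val * (1 - 2 * (if c ≠ e then 1 else 0)) := by
  revert c e; decide

/-- A Kloosterman sum in terms of the number of `x` at which `x + A / x` has trace other
than `e`. -/
lemma kloosterman_eq_card {A : F} (hA : A ≠ 0) (e : ZMod 2) :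
    kloosterman A = (-1) ^ e.val * ((Finset.univ.filter fun x : F => x ≠ 0).card -
      2 * ((Finset.univ.filter fun x : F => x ≠ 0 ∧
        Algebra.trace (ZMod 2) F (x + A / x) ≠ e).card : ℤ)) := by
  have h1 : kloosterman A = ∑ x ∈ Finset.univ.filter (fun x : F => x ≠ 0),
      (-1 : ℤ) ^ (Algebra.trace (ZMod 2) F (x + A / x)).val := by
    unfold kloosterman
    refine Finset.sum_nbij' (fun x => A * x) (fun x => x / A) ?_ ?_ ?_ ?_ ?_
    · simp [hA]
    · simp [hA]
    · intro x _; field_simp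
    · intro x _; field_simp
    · intro x hx
      have hx0 : x ≠ 0 := by simpa using hx
      congr 4
      field_simp
  rw [h1, Finset.sum_congr rfl fun x _ => neg_one_pow_val_eq _ e, ← Finset.mul_sum,
    Finset.sum_sub_distrib, ← Finset.mul_sum, Finset.sum_boole, Finset.filter_filter]
  simp

open Algebra in
lemma card_trace_ne_eq {a : F} (ha : a ≠ 0) :
    (Finset.univ.filter fun x : F => x ≠ 0 ∧
        trace (ZMod 2) F (x + a ^ 3 * (a + 1) / x) ≠ trace (ZMod 2) F a).card =
      (Finset.univ.filter fun z : F => z ≠ 0 ∧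
        trace (ZMod 2) F (z + a * (a + 1) ^ 3 / z) ≠ trace (ZMod 2) F a).card := by
  have h2 : (2 : F) = 0 := two_eq_zero_of_algebra_zmod_two
  have htr (c : ZMod 2) : c + trace (ZMod 2) F (1 + a) ≠ trace (ZMod 2) F 1 ↔
      c ≠ trace (ZMod 2) F a := by
    rw [map_add]
    generalize trace (ZMod 2) F 1 = d
    generalize trace (ZMod 2) F a = e
    revert c d e
    decide
  -- The cubic of `z = t ^ 2 + t + x` has the root `t = x / (x + a ^ 2)`.
  have key {x : F} (hx : x ≠ 0)
      (h : trace (ZMod 2) F (x + a ^ 3 * (a + 1) / x) ≠ trace (ZMod 2) F a) :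
      ∃ t, t ≠ 0 ∧ t + 1 ≠ 0 ∧ t = x / (x + a ^ 2) ∧ x = a ^ 2 * t / (t + 1) ∧
        t ^ 2 + t + x ≠ 0 ∧
        t ^ 3 + (1 + a ^ 2 + (t ^ 2 + t + x)) * t = t ^ 2 + t + x ∧
        trace (ZMod 2) F ((t ^ 2 + t + x) + a * (a + 1) ^ 3 / (t ^ 2 + t + x)) ≠
          trace (ZMod 2) F a := by
    -- At the pole x = a^2 of t, x + A/x equals a^2 + (a^2 + a), whose trace is the excluded value
    -- Tr(a).
    have hxr : x + a ^ 2 ≠ 0 := by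
      intro h0
      have hxa : x = a ^ 2 := by linear_combination h0 - a ^ 2 * h2
      apply h
      rw [← trace_sq a, hxa]
      apply trace_eq_of_add_sq_add (y := a)
      field_simp
    obtain ⟨t, ht⟩ : ∃ t, t = x / (x + a ^ 2) := ⟨_, rfl⟩
    have htx : t * (x + a ^ 2) = x := by rw [ht]; field_simp
    have ht0 : t ≠ 0 := ht ▸ div_ne_zero hx hxr
    have ht1 : t + 1 ≠ 0 := by
      intro h0
      exact pow_ne_zero 2 ha (by linear_combination (x + a ^ 2) * h0 - htx - x * h2)
    have hxt : x = a ^ 2 * t / (t + 1) := by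
      rw [eq_div_iff ht1]
      linear_combination x * t * h2 - htx
    have hroot : t ^ 3 + (1 + a ^ 2 + (t ^ 2 + t + x)) * t = t ^ 2 + t + x := by
      linear_combination htx + t ^ 3 * h2
    have hres := trace_add_div_eq_resolvent ht0 ht1 hxt
    -- If z = 0, the cubic gives 1 + a^2 = t^2, so the trace in `hres` would be Tr(1), which is
    -- excluded.
    have hz : t ^ 2 + t + x ≠ 0 := by
      intro hz
      apply (htr _).mpr h
      rw [hres, hz]
      congr 1
      rw [div_eq_one_iff_eq (pow_ne_zero 2 ht0)]
      apply mul_left_cancel₀ ht0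
      rw [hz] at hroot
      linear_combination hroot - t ^ 3 * h2
    refine ⟨t, ht0, ht1, ht, hxt, hz, hroot, ?_⟩
    rw [← htr, ← trace_resolvent_eq hz, trace_resolvent_of_root hz hroot, ← hres, htr]
    exact h
  refine Finset.card_bij (fun x _ => (x / (x + a ^ 2)) ^ 2 + x / (x + a ^ 2) + x) ?_ ?_ ?_
  · intro x hx
    simp only [Finset.mem_filter, Finset.mem_univ, true_and] at hx ⊢
    obtain ⟨t, -, -, ht, -, hz, -, h⟩ := key hx.1 hx.2
    rw [← ht]
    exact ⟨hz, h⟩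
  · intro x hx y hy hxy
    simp only [Finset.mem_filter, Finset.mem_univ, true_and] at hx hy
    obtain ⟨s, -, -, hs, hxs, hz, hsroot, h⟩ := key hx.1 hx.2
    obtain ⟨t, -, -, ht, hyt, -, htroot, -⟩ := key hy.1 hy.2
    rw [← hs, ← ht] at hxy
    rw [← hxy] at htroot
    -- Distinct points over the same z would give two roots of its cubic, forcing resolvent trace
    -- Tr(1).
    by_contra hne
    have hst : s ≠ t := fun hst => hne (by rw [hxs, hyt, hst])
    rw [← htr, ← trace_resolvent_eq hz] at h
    exact h (trace_resolvent_of_two_roots hz hst hsroot htroot)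
  · intro z hz
    simp only [Finset.mem_filter, Finset.mem_univ, true_and] at hz
    obtain ⟨hz, h⟩ := hz
    rw [← htr, ← trace_resolvent_eq hz] at h
    obtain ⟨t, ht⟩ := exists_root_of_trace_resolvent_ne hz h
    have ht0 : t ≠ 0 := by rintro rfl; apply hz; simpa using ht.symm
    -- Putting t = 1 in the cubic leaves a^2 = 0.
    have ht1 : t + 1 ≠ 0 := by
      intro h0
      apply pow_ne_zero 2 ha
      have : t = 1 := by linear_combination h0 - h2
      subst this
      linear_combination ht - h2
    obtain ⟨x, hx⟩ : ∃ x, x = a ^ 2 * t / (t + 1) := ⟨_, rfl⟩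
    have hx0 : x ≠ 0 := hx ▸ div_ne_zero (mul_ne_zero (pow_ne_zero 2 ha) ht0) ht1
    have hxt : x * (t + 1) = a ^ 2 * t := by rw [hx]; field_simp
    have hzx : t ^ 2 + t + x = z := by
      apply mul_right_cancel₀ ht1
      linear_combination hxt - ht + (t ^ 3 + t ^ 2 + t + a ^ 2 * t - z) * h2
    refine ⟨x, ?_, ?_⟩
    · simp only [Finset.mem_filter, Finset.mem_univ, true_and]
      refine ⟨hx0, ?_⟩
      rw [← htr, trace_add_div_eq_resolvent ht0 ht1 hx, hzx, ← trace_resolvent_of_root hz ht]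
      exact h
    · have hxr : x + a ^ 2 ≠ 0 := by
        intro h0
        apply pow_ne_zero 2 ha
        linear_combination (t + 1) * h0 - hxt - a ^ 2 * t * h2
      have : x / (x + a ^ 2) = t := by
        rw [div_eq_iff hxr]
        linear_combination hxt - x * t * h2
      rw [this, hzx]

/-- The identity `K(a ^ 3 (a + 1)) = K(a (a + 1) ^ 3)`. -/
lemma kloosterman_cube_mul_add_one (a : F) :
    kloosterman (a ^ 3 * (a + 1)) = kloosterman (a * (a + 1) ^ 3) := by
  by_cases ha : a = 0
  · simp [ha]
  by_cases ha1 : a + 1 = 0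
  · simp [ha1]
  have hA : a ^ 3 * (a + 1) ≠ 0 := mul_ne_zero (pow_ne_zero 3 ha) ha1
  have hB : a * (a + 1) ^ 3 ≠ 0 := mul_ne_zero ha (pow_ne_zero 3 ha1)
  rw [kloosterman_eq_card hA (Algebra.trace (ZMod 2) F a),
    kloosterman_eq_card hB (Algebra.trace (ZMod 2) F a), card_trace_ne_eq ha]

end Kloosterman

theorem corollary3 {F : Type*} [Field F] [Fintype F] [DecidableEq F] [Algebra (ZMod 2) F]
    (m : ℕ) (hm : 0 < m) (hF : Fintype.card F = 2 ^ m) (b : F) (hb : 1 + b ≠ 0) :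
    kloosterman ((b ^ 3 + b ^ 2 + 1) * (b ^ 3 + b ^ 2 + b) ^ 3 / (1 + b) ^ 4) =
      kloosterman ((b ^ 3 + b ^ 2 + 1) ^ 3 * (b ^ 3 + b ^ 2 + b) / (1 + b) ^ 4) := by
  have h2 : (2 : F) = 0 := two_eq_zero_of_algebra_zmod_two
  have h : (b ^ 3 + b ^ 2 + 1) / (1 + b) + 1 = (b ^ 3 + b ^ 2 + b) / (1 + b) := by
    field_simp
    linear_combination h2
  have key := kloosterman_cube_mul_add_one ((b ^ 3 + b ^ 2 + 1) / (1 + b))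
  rw [h] at key
  convert key.symm using 2 <;> field_simp
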